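/- **Setting.** A *discrete surface* $S$ consists of a connected simple graph $G=(V,E)$, whose vertices and edges are the points and 1-cells of $S$, and a family of 2-cells. Each 2-cell is bounded by a minimal simple cycle of $G$ (one such that no simple cycle has a proper subset of its vertices as vertex set), and a cell contains the points and 1-cells of its boundary. It is assumed that every 1-cell lies in one or two 2-cells, and that every point $p$ is regular: $p$ lies in finitely many 2-cells, and any two of them are linked by a sequence of 2-cells containing $p$ in which consecutive ones share a 1-cell at $p$. The surface is oriented: each 2-cell has a clockwise direction, and two 2-cells with a common 1-cell run through it in opposite directions. The surface may be finite or infinite. Its boundary $\partial S$ is the set of endpoints of the 1-cells lying in only one 2-cell. Let $a,p,b$ be consecutive points of a directed simple path or simple cycle. The 2-cells on its *clockwise side* at $p$ are those whose clockwise direction runs through $a\to p$ or $p\to b$, together with all 2-cells that can be reached from these around $p$ by crossing only 1-cells at $p$ other than $\{a,p\}$ and $\{p,b\}$. The *counterclockwise side* is the clockwise side of the reversed path. A neighbour $x\ne a,b$ of $p$ is on one of these sides if $\{p,x\}$ lies in a 2-cell of that side. Two simple paths $P,P'$ *cross over* if $P=\dots a\,X\,t\dots$ and $P'=\dots a'\,X\,t'\dots$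 with a common nonempty (possibly one-point) part $X$, $a\neq a'$, $t\ne t'$, where $a'$ (at the first point of $X$) and $t'$ (at the last point of $X$) are on different sides of $P$. They are *gradually varied* if the symmetric difference of their edge sets is the sum modulo 2 of the edge sets of finitely many 2-cells, all of whose points lie on $P\cup P'$. They are *side-gradually varied* if they are gradually varied and do not cross over. The surface $S$ is *simply connected* if for any simple cycle and any two distinct points $p,q$ on it, there is a finite sequence of simple paths from $p$ to $q$ that starts with one of the two arcs of the cycle from $p$ to $q$, ends with the other arc, and in which consecutive paths are side-gradually varied. Add to $S$ a central pseudo-point (Veblen point) for each 1-cell and each 2-cell. The pseudo-point of a 1-cell is adjacent to the two endpoints of that 1-cell; the pseudo-point of a 2-cell is adjacent to the points of that 2-cell and to the pseudo-points of its 1-cells. For a simple cycle $C$ in $G$, let $S-C$ be obtained by removing the points of $C$ and the pseudo-points of the 1-cells of $C$. **Theorem 2 (Jordan curve theorem for generalized simple closed paths).** Let $S$ be a simply connected discrete surface and let $C$ be a simple cycle (closed simple path, possibly the boundary of a 2-cell) of $S$, with a direction of travel, that contains no point of $\partial S$. Then $S-C$ has exactly two connected components. More precisely, the pseudo-points of all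 2-cells that are on the clockwise side of $C$ at some point of $C$ are connected to each other in $S-C$; so are those of all 2-cells on the counterclockwise side; every point of $S-C$ is connected in $S-C$ to the pseudo-point of a 2-cell of one of these two kinds; and the pseudo-point of a 2-cell on the clockwise side is never connected in $S-C$ to that of a 2-cell on the counterclockwise side. -/

import Mathlib

universe u v

/-- The walk `w` passes from `x` directly to `y`. -/
def SimpleGraph.Walk.Traverses {V : Type u} {G : SimpleGraph V} {a b : V} (w : G.Walk a b)
    (x y : V) : Prop :=
  ∃ h : G.Adj x y, (⟨(x, y), h⟩ : G.Dart) ∈ w.darts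

/-- A discrete surface, regular and oriented: a connected simple graph `G` on the points `V`,
with 2-cells indexed by `F`. The boundary of the 2-cell `A` is the closed walk `bd A`, whose
direction of travel is the clockwise direction of `A`. The surface may have a boundary, and it
may be infinite (but is locally finite). -/
structure DiscreteSurface (V : Type u) (F : Type v) where
  /-- the points and the 1-cells -/
  G : SimpleGraph V
  connected : G.Connected
  /-- the starting point of the boundary walk of a 2-cell -/
  base : F → V
  /-- the boundary of a 2-cell, in clockwise direction -/
  bd : (A : F) → G.Walk (base A) (base A)
  /-- the boundary of a 2-cell is a simple cycle ... -/
  isCycle : ∀ A, (bd A).IsCycle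
  /-- ... and a minimal one: no simple cycle has a proper subset of its points as point set -/
  minimal : ∀ (A : F) (w : V) (d : G.Walk w w), d.IsCycle →
    d.support ⊆ (bd A).support → (bd A).support ⊆ d.support
  /-- every 1-cell lies in one or two 2-cells -/
  one_or_two : ∀ e ∈ G.edgeSet,
    {A : F | e ∈ (bd A).edges}.encard = 1 ∨ {A : F | e ∈ (bd A).edges}.encard = 2
  /-- orientation: two 2-cells with a common 1-cell run through it in opposite directions -/
  coherent : ∀ A B : F, A ≠ B → ∀ x y, (bd A).Traverses x y → ¬ (bd B).Traverses x y
  /-- every point lies in finitely many 2-cells -/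
  finite_star : ∀ p : V, {A : F | p ∈ (bd A).support}.Finite
  /-- every point is regular: the 2-cells that contain it are connected to each other around
  it, two successive ones having a 1-cell at that point in common -/
  regular : ∀ (p : V) (A B : F), p ∈ (bd A).support → p ∈ (bd B).support →
    Relation.ReflTransGen
      (fun X Y => ∃ x, s(p, x) ∈ (bd X).edges ∧ s(p, x) ∈ (bd Y).edges) A B

namespace DiscreteSurface

variable {V : Type u} {F : Type v} (S : DiscreteSurface V F)

/-- `∂S`: the points of the 1-cells that lie in only one 2-cell. -/
def boundary : Set V :=
  {p | ∃ e ∈ S.G.edgeSet, p ∈ e ∧ {A : F | e ∈ (S.bd A).edges}.encard = 1}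

/-! ### The two sides of a path at one of its points -/

/-- The 2-cells `A` and `B` are connected around the point `p` by 2-cells, two successive ones
sharing a 1-cell `{p, x}` with `x ∉ T`. -/
def FanConnected (p : V) (T : Set V) (A B : F) : Prop :=
  Relation.ReflTransGen
    (fun X Y => ∃ x, x ∉ T ∧ s(p, x) ∈ (S.bd X).edges ∧ s(p, x) ∈ (S.bd Y).edges) A B

/-- The 2-cells at `p` on the clockwise side of `a → p → b`: those that run through `a → p` or
`p → b` in clockwise direction, and those connected to them around `p` without crossing the
1-cells `{a, p}` and `{p, b}`. -/
def clockwisePart (a p b : V) : Set F :=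
  {A | ∃ A₀, ((S.bd A₀).Traverses a p ∨ (S.bd A₀).Traverses p b) ∧ S.FanConnected p {a, b} A₀ A}

/-- The 2-cells at `p` on the counterclockwise side of `a → p → b`. -/
def counterclockwisePart (a p b : V) : Set F := S.clockwisePart b p a

variable {S}

/-- The neighbour `x` of the interior point `p` of the path `C` is strictly on the clockwise
side of `C` at `p`. -/
def ClockwiseAt {s t : V} (C : S.G.Walk s t) (p x : V) : Prop :=
  ∃ a b, C.Traverses a p ∧ C.Traverses p b ∧ x ≠ a ∧ x ≠ b ∧
    ∃ A ∈ S.clockwisePart a p b, s(p, x) ∈ (S.bd A).edges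

/-- The neighbour `x` of the interior point `p` of the path `C` is strictly on the
counterclockwise side of `C` at `p`. -/
def CounterclockwiseAt {s t : V} (C : S.G.Walk s t) (p x : V) : Prop :=
  ∃ a b, C.Traverses a p ∧ C.Traverses p b ∧ x ≠ a ∧ x ≠ b ∧
    ∃ A ∈ S.counterclockwisePart a p b, s(p, x) ∈ (S.bd A).edges

/-! ### Cross-over, gradual variation and simply connected surfaces -/

/-- Two simple paths cross over each other: they have a common part `X`, which may be a single
point, `C = … a X t …` and `C' = … a' X t' …` with `a ≠ a'` and `t ≠ t'`, and `C'` arrives at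
the first point of `X` from one side of `C` and leaves its last point to the other side. -/
def CrossOver {s t s' t' : V} (C : S.G.Walk s t) (C' : S.G.Walk s' t') : Prop :=
  ∃ (X : List V) (hX : X ≠ []) (a a' b b' : V),
    (a :: X ++ [b]) <:+: C.support ∧ (a' :: X ++ [b']) <:+: C'.support ∧ a ≠ a' ∧ b ≠ b' ∧
    ((ClockwiseAt C (X.head hX) a' ∧ CounterclockwiseAt C (X.getLast hX) b') ∨
      (CounterclockwiseAt C (X.head hX) a' ∧ ClockwiseAt C (X.getLast hX) b'))

/-- Two simple paths are gradually varied: the symmetric difference of their sets of 1-cells is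
the sum modulo 2 of 2-cells all of whose points lie on the two paths. -/
def GraduallyVaried {s t s' t' : V} (C : S.G.Walk s t) (C' : S.G.Walk s' t') : Prop :=
  ∃ D : Finset F,
    (∀ A ∈ D, ∀ x ∈ (S.bd A).support, x ∈ C.support ∨ x ∈ C'.support) ∧
    ∀ e : Sym2 V, e ∈ symmDiff {e | e ∈ C.edges} {e | e ∈ C'.edges} ↔
      Odd {A : F | A ∈ D ∧ e ∈ (S.bd A).edges}.ncard

/-- Two simple paths are side-gradually varied. -/
def SideGraduallyVaried {s t s' t' : V} (C : S.G.Walk s t) (C' : S.G.Walk s' t') : Prop :=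
  GraduallyVaried C C' ∧ ¬ CrossOver C C'

variable (S)

/-- `S` is simply connected: whenever two points `p`, `q` divide a simple cycle into two arcs
from `p` to `q`, there is a finite sequence of simple paths from `p` to `q` that leads from one
arc to the other, each side-gradually varied with the next one. -/
def SimplyConnected : Prop :=
  ∀ (p q : V) (P Q : S.G.Path p q),
    ((P : S.G.Walk p q).append (Q : S.G.Walk p q).reverse).IsCycle →
    Relation.ReflTransGen
      (fun R R' : S.G.Path p q => SideGraduallyVaried (R : S.G.Walk p q) (R' : S.G.Walk p q)) P Q

/-! ### The surface with its central pseudo-points -/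

/-- The points of `S` together with the central pseudo-points (Veblen points) of its 1-cells
and 2-cells. -/
inductive VeblenPoint (S : DiscreteSurface V F) : Type (max u v)
  | vertex (p : V) : VeblenPoint S
  | edge (e : S.G.edgeSet) : VeblenPoint S
  | cell (A : F) : VeblenPoint S

/-- The central pseudo-point of a cell is joined to the points of that cell and, for a 2-cell,
to the central pseudo-points of its 1-cells. -/
inductive VeblenIncident : VeblenPoint S → VeblenPoint S → Prop
  | vertex_edge (p : V) (e : S.G.edgeSet) (h : p ∈ (e : Sym2 V)) :
      VeblenIncident (.vertex p) (.edge e)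
  | vertex_cell (p : V) (A : F) (h : p ∈ (S.bd A).support) :
      VeblenIncident (.vertex p) (.cell A)
  | edge_cell (e : S.G.edgeSet) (A : F) (h : (e : Sym2 V) ∈ (S.bd A).edges) :
      VeblenIncident (.edge e) (.cell A)

/-- The graph of adjacency on `S` with its central pseudo-points. -/
def veblenGraph : SimpleGraph (VeblenPoint S) := SimpleGraph.fromRel S.VeblenIncident

variable {S}

/-- `S - C`: the points that are not on `C`, the central pseudo-points of the 1-cells that are
not on `C`, and the central pseudo-points of all 2-cells. -/
def off {s t : V} (C : S.G.Walk s t) : Set (VeblenPoint S) :=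
  {x | match x with
    | .vertex p => p ∉ C.support
    | .edge e => (e : Sym2 V) ∉ C.edges
    | .cell _ => True}

/-- The graph of adjacency on `S - C`. -/
def offGraph {s t : V} (C : S.G.Walk s t) : SimpleGraph (off C) := S.veblenGraph.induce (off C)

/-- The central pseudo-point of the 2-cell `A`, as a point of `S - C`. -/
def cellPoint {s t : V} (C : S.G.Walk s t) (A : F) : off C := ⟨.cell A, trivial⟩

/-- The 2-cell `A` meets `C` on the clockwise side. -/
def MeetsClockwise {s t : V} (C : S.G.Walk s t) (A : F) : Prop :=
  ∃ a p b, C.Traverses a p ∧ C.Traverses p b ∧ A ∈ S.clockwisePart a p b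

/-- The 2-cell `A` meets `C` on the counterclockwise side. -/
def MeetsCounterclockwise {s t : V} (C : S.G.Walk s t) (A : F) : Prop :=
  ∃ a p b, C.Traverses a p ∧ C.Traverses p b ∧ A ∈ S.counterclockwisePart a p b

end DiscreteSurface

/-!
A simple cycle `C` is the sum of two arcs, and simple connectivity deforms one arc into the other
through paths whose successive symmetric differences are sums modulo 2 of boundaries of 2-cells.
Adding up, the edge set of `C` is itself the boundary modulo 2 of a finite set `D` of 2-cells
(`SimplyConnected.exists_isMod2Boundary`). So two distinct 2-cells sharing a 1-cell `e` are
separated by `D` exactly if `e` is on `C` (`IsMod2Boundary.mem_edges_iff`); hence membership in `D`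
extends to a property of the points of `S - C` that is constant on components
(`IsMod2Boundary.inside_iff_of_reachable`), and the two 2-cells at a 1-cell of `C` lie in different
components.

That there are no more than two components is local. At an interior point `p` with `a → p → b` on
`C`, the 2-cell running through `a → p` and the one running through `p → b` are connected around `p`
without crossing `{a, p}` or `{p, b}` (`fanConnected_of_traverses`): otherwise a counting argument
shows that the 2-cells reached from the first one are closed under crossing all 1-cells at `p`, so
they are all 2-cells at `p`. Following `C` connects all 2-cells of the clockwise side
(`linked_of_meetsClockwise`); reversing `C` gives the counterclockwise side. Every 2-cell that
meets `C` is on one of the sides, and connectedness of the graph leads from any point to such a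
2-cell.
-/

/-! ### Traversals of walks and cycles -/

namespace SimpleGraph.Walk

variable {V : Type u} {G : SimpleGraph V}

theorem Traverses.adj {a b x y : V} {w : G.Walk a b} (h : w.Traverses x y) : G.Adj x y := h.1

theorem Traverses.mem_edges {a b x y : V} {w : G.Walk a b} (h : w.Traverses x y) :
    s(x, y) ∈ w.edges := by
  obtain ⟨h, hd⟩ := h
  exact List.mem_map.2 ⟨_, hd, rfl⟩

theorem Traverses.fst_mem {a b x y : V} {w : G.Walk a b} (h : w.Traverses x y) :
    x ∈ w.support :=
  w.fst_mem_support_of_mem_edges h.mem_edges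

theorem Traverses.snd_mem {a b x y : V} {w : G.Walk a b} (h : w.Traverses x y) :
    y ∈ w.support :=
  w.snd_mem_support_of_mem_edges h.mem_edges

theorem traverses_of_dart_mem {a b : V} {w : G.Walk a b} {d : G.Dart} (h : d ∈ w.darts) :
    w.Traverses d.fst d.snd :=
  ⟨d.adj, h⟩

theorem mem_edges_iff_traverses {a b x y : V} {w : G.Walk a b} :
    s(x, y) ∈ w.edges ↔ w.Traverses x y ∨ w.Traverses y x := by
  constructor
  · intro h
    obtain ⟨d, hd, he⟩ := List.mem_map.1 h
    have := traverses_of_dart_mem hd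
    rcases (dart_edge_eq_mk'_iff').1 he with ⟨h1, h2⟩ | ⟨h1, h2⟩
    · left; rwa [h1, h2] at this
    · right; rwa [h1, h2] at this
  · rintro (h | h)
    · exact h.mem_edges
    · rw [Sym2.eq_swap]; exact h.mem_edges

theorem traverses_reverse {a b x y : V} {w : G.Walk a b} :
    w.reverse.Traverses x y ↔ w.Traverses y x := by
  constructor
  · rintro ⟨h, hd⟩
    rw [mem_darts_reverse] at hd
    exact ⟨h.symm, hd⟩
  · rintro ⟨h, hd⟩
    refine ⟨h.symm, ?_⟩
    rw [mem_darts_reverse]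
    exact hd

theorem IsCycle.exists_traverses_to {a p : V} {w : G.Walk a a} (hw : w.IsCycle)
    (hp : p ∈ w.support) : ∃ x, w.Traverses x p := by
  have hp' : p ∈ w.support.tail := by
    rw [← cons_tail_support, List.mem_cons] at hp
    rcases hp with rfl | hp
    · exact end_mem_tail_support hw.not_nil
    · exact hp
  rw [← map_snd_darts] at hp'
  obtain ⟨d, hd, rfl⟩ := List.mem_map.1 hp'
  exact ⟨_, traverses_of_dart_mem hd⟩

theorem IsCycle.exists_traverses_from {a p : V} {w : G.Walk a a} (hw : w.IsCycle)
    (hp : p ∈ w.support) : ∃ x, w.Traverses p x := by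
  obtain ⟨x, hx⟩ := hw.reverse.exists_traverses_to (p := p) (by simpa using hp)
  exact ⟨x, traverses_reverse.1 hx⟩

theorem IsCycle.not_traverses_swap {a x y : V} {w : G.Walk a a} (hw : w.IsCycle)
    (h : w.Traverses x y) : ¬ w.Traverses y x := by
  rintro ⟨h', hd'⟩
  obtain ⟨h, hd⟩ := h
  have := List.inj_on_of_nodup_map (f := Dart.edge) hw.edges_nodup hd hd' Sym2.eq_swap
  exact h.ne (congrArg (fun d : G.Dart => d.fst) this)

theorem IsCycle.eq_or_eq_of_mem_edges {a x p y z : V} {w : G.Walk a a} (hw : w.IsCycle)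
    (hx : w.Traverses x p) (hy : w.Traverses p y) (hz : s(p, z) ∈ w.edges) : z = x ∨ z = y := by
  have hne : x ≠ y := by
    rintro rfl
    exact hw.not_traverses_swap hx hy
  have hn (t : V) : t ∈ w.toSubgraph.neighborSet p ↔ s(p, t) ∈ w.edges := by
    rw [← mem_edges_toSubgraph]; rfl
  obtain ⟨u, v, -, huv⟩ := Set.ncard_eq_two.1
    (hw.ncard_neighborSet_toSubgraph_eq_two hx.snd_mem)
  have hx' := (hn x).2 (mem_edges_iff_traverses.2 (.inr hx))
  have hy' := (hn y).2 (mem_edges_iff_traverses.2 (.inl hy))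
  have hz' := (hn z).2 hz
  rw [huv] at hx' hy' hz'
  simp only [Set.mem_insert_iff, Set.mem_singleton_iff] at hx' hy' hz'
  grind

/-- The darts of a walk are all equivalent as soon as consecutive ones are. -/
theorem rel_of_rel_consecutive {a b : V} (w : G.Walk a b) {r : G.Dart → G.Dart → Prop}
    (hr : Equivalence r)
    (h : ∀ d ∈ w.darts, ∀ d' ∈ w.darts, d.snd = d'.fst → r d d') :
    ∀ d ∈ w.darts, ∀ d' ∈ w.darts, r d d' := by
  have hc : List.IsChain r w.darts :=
    w.isChain_dartAdj_darts.imp_of_mem_imp fun d d' hd hd' hdd => h d hd d' hd' hdd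
  have : Trans r r r := ⟨hr.trans⟩
  have : Std.Symm r := ⟨fun _ _ => hr.symm⟩
  intro d hd d' hd'
  exact (List.isChain_iff_pairwise.1 hc).forall_of_forall (fun x _ => hr.refl x) hd hd'

end SimpleGraph.Walk

namespace DiscreteSurface

open SimpleGraph.Walk

variable {V : Type u} {F : Type v} {S : DiscreteSurface V F}

/-! ### The 2-cells around an interior point -/

theorem eq_of_traverses {A B : F} {x y : V} (hA : (S.bd A).Traverses x y)
    (hB : (S.bd B).Traverses x y) : A = B := by
  by_contra h
  exact S.coherent A B h x y hA hB

theorem exists_mem_edges {e : Sym2 V} (he : e ∈ S.G.edgeSet) : ∃ A, e ∈ (S.bd A).edges := by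
  have : {A : F | e ∈ (S.bd A).edges}.Nonempty := by
    rw [← Set.encard_ne_zero]
    rcases S.one_or_two e he with h | h <;> simp [h]
  exact this

theorem exists_traverses {p x : V} (hp : p ∉ S.boundary) (h : S.G.Adj p x) :
    (∃ A, (S.bd A).Traverses x p) ∧ ∃ A, (S.bd A).Traverses p x := by
  have h2 : {A : F | s(p, x) ∈ (S.bd A).edges}.encard = 2 :=
    (S.one_or_two s(p, x) h).resolve_left fun h1 => hp ⟨_, h, Sym2.mem_mk_left _ _, h1⟩
  obtain ⟨A, B, hne, hAB⟩ := Set.encard_eq_two.1 h2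
  have hA : s(p, x) ∈ (S.bd A).edges := by
    have : A ∈ {A : F | s(p, x) ∈ (S.bd A).edges} := by simp [hAB]
    exact this
  have hB : s(p, x) ∈ (S.bd B).edges := by
    have : B ∈ {A : F | s(p, x) ∈ (S.bd A).edges} := by simp [hAB]
    exact this
  rcases mem_edges_iff_traverses.1 hA with hA | hA <;>
    rcases mem_edges_iff_traverses.1 hB with hB | hB
  · exact absurd (eq_of_traverses hA hB) hne
  · exact ⟨⟨B, hB⟩, ⟨A, hA⟩⟩
  · exact ⟨⟨A, hA⟩, ⟨B, hB⟩⟩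
  · exact absurd (eq_of_traverses hA hB) hne

theorem FanConnected.symm {p : V} {T : Set V} {A B : F} (h : S.FanConnected p T A B) :
    S.FanConnected p T B A := by
  induction h with
  | refl => exact .refl
  | tail _ h ih =>
    obtain ⟨x, hx, h1, h2⟩ := h
    exact .head ⟨x, hx, h2, h1⟩ ih

theorem FanConnected.mem_support {p : V} {T : Set V} {A B : F} (h : S.FanConnected p T A B)
    (hA : p ∈ (S.bd A).support) : p ∈ (S.bd B).support := by
  induction h with
  | refl => exact hA
  | tail _ h _ =>
    obtain ⟨x, -, -, h2⟩ := h
    exact fst_mem_support_of_mem_edges _ h2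

/-- On each side of `a → p → b` there is only one fan of 2-cells at the interior point `p`. -/
theorem fanConnected_of_traverses {a p b : V} (hp : p ∉ S.boundary) {A B : F}
    (hA : (S.bd A).Traverses a p) (hB : (S.bd B).Traverses p b) :
    S.FanConnected p {a, b} A B := by
  classical
  -- `f X → p → g X` is the passage of the 2-cell `X` through `p`
  have hf : ∀ X : F, ∃ x, p ∈ (S.bd X).support → (S.bd X).Traverses x p := fun X => by
    by_cases h : p ∈ (S.bd X).support
    · obtain ⟨x, hx⟩ := (S.isCycle X).exists_traverses_to h
      exact ⟨x, fun _ => hx⟩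
    · exact ⟨p, fun h' => absurd h' h⟩
  have hg : ∀ X : F, ∃ x, p ∈ (S.bd X).support → (S.bd X).Traverses p x := fun X => by
    by_cases h : p ∈ (S.bd X).support
    · obtain ⟨x, hx⟩ := (S.isCycle X).exists_traverses_from h
      exact ⟨x, fun _ => hx⟩
    · exact ⟨p, fun h' => absurd h' h⟩
  choose f hf using hf
  choose g hg using hg
  have hfu {X : F} {x : V} (h : (S.bd X).Traverses x p) : x = f X := by
    have hX := h.snd_mem
    refine ((S.isCycle X).eq_or_eq_of_mem_edges (hf X hX) (hg X hX)
      (mem_edges_iff_traverses.2 (.inr h))).resolve_right ?_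
    rintro rfl
    exact (S.isCycle X).not_traverses_swap h (hg X hX)
  have hgu {X : F} {x : V} (h : (S.bd X).Traverses p x) : x = g X := by
    have hX := h.fst_mem
    refine ((S.isCycle X).eq_or_eq_of_mem_edges (hf X hX) (hg X hX)
      (mem_edges_iff_traverses.2 (.inl h))).resolve_left ?_
    rintro rfl
    exact (S.isCycle X).not_traverses_swap h (hf X hX)
  by_contra hcon
  have hfin : {X : F | S.FanConnected p {a, b} A X}.Finite :=
    (S.finite_star p).subset fun X hX => FanConnected.mem_support hX hA.snd_mem
  set P : Finset F := hfin.toFinset with hP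
  have hPm (X : F) : X ∈ P ↔ S.FanConnected p {a, b} A X := by simp [hP]
  have hPs {X : F} (h : X ∈ P) : p ∈ (S.bd X).support :=
    FanConnected.mem_support ((hPm X).1 h) hA.snd_mem
  have hAP : A ∈ P := (hPm A).2 .refl
  have hsub : P.image g ⊆ P.image f := by
    intro y hy
    obtain ⟨X, hX, rfl⟩ := Finset.mem_image.1 hy
    have hXg := hg X (hPs hX)
    by_cases hya : g X = a
    · exact Finset.mem_image.2 ⟨A, hAP, by rw [hya]; exact (hfu hA).symm⟩
    have hyb : g X ≠ b := fun h => by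
      rw [h] at hXg
      exact hcon (eq_of_traverses hXg hB ▸ (hPm X).1 hX)
    obtain ⟨Y, hY⟩ := (exists_traverses hp hXg.adj).1
    refine Finset.mem_image.2 ⟨Y, (hPm Y).2 (((hPm X).1 hX).tail ⟨g X, ?_, ?_, ?_⟩), (hfu hY).symm⟩
    · simp [hya, hyb]
    · exact hXg.mem_edges
    · exact mem_edges_iff_traverses.2 (.inr hY)
  have hfi : Set.InjOn f P := fun X hX Y hY h =>
    eq_of_traverses (hf X (hPs hX)) (h ▸ hf Y (hPs hY))
  have hgi : Set.InjOn g P := fun X hX Y hY h =>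
    eq_of_traverses (hg X (hPs hX)) (h ▸ hg Y (hPs hY))
  -- `f` and `g` are injective on `P` by coherence, so both images have as many elements as `P`
  have heq : P.image g = P.image f := Finset.eq_of_subset_of_card_le hsub (by
    rw [Finset.card_image_of_injOn hfi, Finset.card_image_of_injOn hgi])
  -- each 1-cell that `P` enters by is one that it leaves by, so no 2-cell outside `P` is adjacent
  have hclosed {X Y : F} {x : V} (hX : X ∈ P) (h1 : s(p, x) ∈ (S.bd X).edges)
      (h2 : s(p, x) ∈ (S.bd Y).edges) : Y ∈ P := by
    have hxf : x ∈ P.image f := by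
      rcases mem_edges_iff_traverses.1 h1 with h | h
      · rw [← heq, hgu h]; exact Finset.mem_image_of_mem _ hX
      · rw [hfu h]; exact Finset.mem_image_of_mem _ hX
    rcases mem_edges_iff_traverses.1 h2 with h | h
    · rw [← heq] at hxf
      obtain ⟨Z, hZ, rfl⟩ := Finset.mem_image.1 hxf
      rwa [eq_of_traverses h (hg Z (hPs hZ))]
    · obtain ⟨Z, hZ, rfl⟩ := Finset.mem_image.1 hxf
      rwa [eq_of_traverses h (hf Z (hPs hZ))]
  have hBP : B ∈ P := by
    have hreg := S.regular p A B hA.snd_mem hB.fst_mem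
    clear hcon hsub hB
    induction hreg with
    | refl => exact hAP
    | tail _ h ih =>
      obtain ⟨x, h1, h2⟩ := h
      exact hclosed ih h1 h2
  exact hcon ((hPm B).1 hBP)

theorem fanConnected_of_mem_clockwisePart {a p b : V} (hp : p ∉ S.boundary) {A B : F}
    (hA : A ∈ S.clockwisePart a p b) (hB : B ∈ S.clockwisePart a p b) :
    S.FanConnected p {a, b} A B := by
  obtain ⟨A₀, hA₀, hA⟩ := hA
  obtain ⟨B₀, hB₀, hB⟩ := hB
  refine hA.symm.trans (Relation.ReflTransGen.trans ?_ hB)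
  rcases hA₀ with hA₀ | hA₀ <;> rcases hB₀ with hB₀ | hB₀
  · rw [eq_of_traverses hA₀ hB₀]
  · exact fanConnected_of_traverses hp hA₀ hB₀
  · exact (fanConnected_of_traverses hp hB₀ hA₀).symm
  · rw [eq_of_traverses hA₀ hB₀]

/-- Going around `p` from a 2-cell at `{p, a}`, a change of side happens only across `{p, a}` or
`{p, b}`, whose 2-cells are on one of the sides by definition. -/
theorem mem_clockwisePart_or {a p b : V} (hap : S.G.Adj a p) {A : F}
    (hA : p ∈ (S.bd A).support) :
    A ∈ S.clockwisePart a p b ∨ A ∈ S.counterclockwisePart a p b := by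
  have start {X : F} {x : V} (hx : x = a ∨ x = b) (hX : s(p, x) ∈ (S.bd X).edges) :
      X ∈ S.clockwisePart a p b ∨ X ∈ S.counterclockwisePart a p b := by
    rcases hx with rfl | rfl <;> rcases mem_edges_iff_traverses.1 hX with h | h
    · exact .inr ⟨X, .inr h, .refl⟩
    · exact .inl ⟨X, .inl h, .refl⟩
    · exact .inl ⟨X, .inr h, .refl⟩
    · exact .inr ⟨X, .inl h, .refl⟩
  obtain ⟨A₀, hA₀⟩ := exists_mem_edges (S := S) (e := s(p, a)) hap.symm
  have := S.regular p A₀ A (fst_mem_support_of_mem_edges _ hA₀) hA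
  induction this with
  | refl => exact start (.inl rfl) hA₀
  | tail _ h ih =>
    obtain ⟨x, h1, h2⟩ := h
    by_cases hx : x = a ∨ x = b
    · exact start hx h2
    · rcases ih (fst_mem_support_of_mem_edges _ h1) with ⟨X, hX, hXY⟩ | ⟨X, hX, hXY⟩
      · exact .inl ⟨X, hX, hXY.tail ⟨x, by simpa using hx, h1, h2⟩⟩
      · exact .inr ⟨X, hX, hXY.tail ⟨x, by simpa [or_comm] using hx, h1, h2⟩⟩

/-! ### Linking 2-cells along one side of a cycle -/

variable (S) in
/-- The 2-cells `A` and `B` are joined by a sequence of 2-cells, two successive ones sharing a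
1-cell that is not in `K`. -/
def Linked (K : Set (Sym2 V)) (A B : F) : Prop :=
  Relation.ReflTransGen (fun X Y => ∃ e ∉ K, e ∈ (S.bd X).edges ∧ e ∈ (S.bd Y).edges) A B

theorem Linked.symm {K : Set (Sym2 V)} {A B : F} (h : S.Linked K A B) : S.Linked K B A := by
  induction h with
  | refl => exact .refl
  | tail _ h ih =>
    obtain ⟨x, hx, h1, h2⟩ := h
    exact .head ⟨x, hx, h2, h1⟩ ih

theorem FanConnected.linked {K : Set (Sym2 V)} {p : V} {T : Set V} {A B : F}
    (h : S.FanConnected p T A B) (hT : ∀ x, s(p, x) ∈ K → x ∈ T) : S.Linked K A B :=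
  Relation.ReflTransGen.mono
    (fun _ _ ⟨x, hx, h1, h2⟩ => ⟨s(p, x), fun hK => hx (hT x hK), h1, h2⟩) _ _ h

theorem linked_of_mem_clockwisePart {v₀ a p b : V} {C : S.G.Walk v₀ v₀} (hC : C.IsCycle)
    (hp : p ∉ S.boundary) (ha : C.Traverses a p) (hb : C.Traverses p b) {A B : F}
    (hA : A ∈ S.clockwisePart a p b) (hB : B ∈ S.clockwisePart a p b) :
    S.Linked {e | e ∈ C.edges} A B :=
  (fanConnected_of_mem_clockwisePart hp hA hB).linked
    fun _ hx => hC.eq_or_eq_of_mem_edges ha hb hx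

theorem linked_of_meetsClockwise {v₀ : V} {C : S.G.Walk v₀ v₀} (hC : C.IsCycle)
    (hCb : ∀ p ∈ C.support, p ∉ S.boundary) {A B : F} (hA : MeetsClockwise C A)
    (hB : MeetsClockwise C B) : S.Linked {e | e ∈ C.edges} A B := by
  obtain ⟨a, p, b, ha, hb, hA⟩ := hA
  obtain ⟨a', p', b', ha', hb', hB⟩ := hB
  have hex (d : S.G.Dart) : ∃ X, d ∈ C.darts → (S.bd X).Traverses d.fst d.snd := by
    by_cases hd : d ∈ C.darts
    · obtain ⟨X, hX⟩ := (exists_traverses (hCb _ (traverses_of_dart_mem hd).snd_mem) d.adj.symm).1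
      exact ⟨X, fun _ => hX⟩
    · exact ⟨A, fun h => absurd h hd⟩
  choose L hL using hex
  have key := C.rel_of_rel_consecutive
    (r := fun d d' => S.Linked {e | e ∈ C.edges} (L d) (L d'))
    ⟨fun _ => .refl, Linked.symm, Relation.ReflTransGen.trans⟩ (by
      intro d hd d' hd' h
      have t := traverses_of_dart_mem hd
      have t' := traverses_of_dart_mem hd'
      have l' := hL d' hd'
      rw [← h] at t' l'
      exact linked_of_mem_clockwisePart hC (hCb _ t.snd_mem) t t'
        ⟨_, .inl (hL d hd), .refl⟩ ⟨_, .inr l', .refl⟩)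
  obtain ⟨h1, hd1⟩ := id ha
  obtain ⟨h2, hd2⟩ := id ha'
  have e1 := linked_of_mem_clockwisePart hC (hCb _ ha.snd_mem) ha hb hA ⟨_, .inl (hL _ hd1), .refl⟩
  have e2 := linked_of_mem_clockwisePart hC (hCb _ ha'.snd_mem) ha' hb'
    ⟨_, .inl (hL _ hd2), .refl⟩ hB
  exact e1.trans ((key _ hd1 _ hd2).trans e2)

theorem MeetsCounterclockwise.reverse {v₀ : V} {C : S.G.Walk v₀ v₀} {A : F}
    (h : MeetsCounterclockwise C A) : MeetsClockwise C.reverse A := by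
  obtain ⟨a, p, b, ha, hb, hA⟩ := h
  exact ⟨b, p, a, traverses_reverse.2 hb, traverses_reverse.2 ha, hA⟩

theorem linked_of_meetsCounterclockwise {v₀ : V} {C : S.G.Walk v₀ v₀} (hC : C.IsCycle)
    (hCb : ∀ p ∈ C.support, p ∉ S.boundary) {A B : F} (hA : MeetsCounterclockwise C A)
    (hB : MeetsCounterclockwise C B) : S.Linked {e | e ∈ C.edges} A B := by
  simpa using linked_of_meetsClockwise hC.reverse (by simpa using hCb) hA.reverse hB.reverse

theorem meets_of_mem_support {v₀ p : V} {C : S.G.Walk v₀ v₀} (hC : C.IsCycle)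
    (hp : p ∈ C.support) {A : F} (hA : p ∈ (S.bd A).support) :
    MeetsClockwise C A ∨ MeetsCounterclockwise C A := by
  obtain ⟨a, ha⟩ := hC.exists_traverses_to hp
  obtain ⟨b, hb⟩ := hC.exists_traverses_from hp
  exact (mem_clockwisePart_or ha.adj hA).imp (⟨a, p, b, ha, hb, ·⟩) (⟨a, p, b, ha, hb, ·⟩)

/-- The two 2-cells at a 1-cell of a cycle, here the one arriving at `v₀`, are on different sides of the cycle. -/
theorem exists_opposite_cells {v₀ : V} {C : S.G.Walk v₀ v₀} (hC : C.IsCycle)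
    (hCb : ∀ p ∈ C.support, p ∉ S.boundary) :
    ∃ A B : F, A ≠ B ∧ MeetsClockwise C A ∧ MeetsCounterclockwise C B ∧
      ∃ e ∈ C.edges, e ∈ (S.bd A).edges ∧ e ∈ (S.bd B).edges := by
  have h₀ := C.start_mem_support
  obtain ⟨a, ha⟩ := hC.exists_traverses_to h₀
  obtain ⟨b, hb⟩ := hC.exists_traverses_from h₀
  obtain ⟨⟨A, hA⟩, ⟨B, hB⟩⟩ := exists_traverses (hCb _ h₀) ha.adj.symm
  refine ⟨A, B, ?_, ⟨a, v₀, b, ha, hb, A, .inl hA, .refl⟩, ⟨a, v₀, b, ha, hb, B, .inr hB, .refl⟩,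
    s(a, v₀), ha.mem_edges, hA.mem_edges, mem_edges_iff_traverses.2 (.inr hB)⟩
  rintro rfl
  exact (S.isCycle A).not_traverses_swap hA hB

/-! ### Paths between the points of `S - C` -/

theorem offGraph_reachable {v₀ : V} {C : S.G.Walk v₀ v₀} {x y : off C}
    (h : S.VeblenIncident x y) : (offGraph C).Reachable x y := by
  refine SimpleGraph.Adj.reachable (SimpleGraph.induce_adj.2 ?_)
  refine (SimpleGraph.fromRel_adj _ _ _).2 ⟨?_, .inl h⟩
  intro hxy
  rw [hxy] at h
  generalize (y : VeblenPoint S) = z at h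
  cases h

theorem Linked.reachable {v₀ : V} {C : S.G.Walk v₀ v₀} {A B : F}
    (h : S.Linked {e | e ∈ C.edges} A B) :
    (offGraph C).Reachable (cellPoint C A) (cellPoint C B) := by
  induction h with
  | refl => exact .refl _
  | @tail X Y _ h ih =>
    obtain ⟨e, he, h1, h2⟩ := h
    let z : off C := ⟨.edge ⟨e, edges_subset_edgeSet _ h1⟩, he⟩
    have r1 : (offGraph C).Reachable z (cellPoint C X) := offGraph_reachable (.edge_cell _ _ h1)
    have r2 : (offGraph C).Reachable z (cellPoint C Y) := offGraph_reachable (.edge_cell _ _ h2)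
    exact ih.trans (r1.symm.trans r2)

theorem vertex_reachable_cell {v₀ p : V} {C : S.G.Walk v₀ v₀} (hp : p ∉ C.support) {A : F}
    (hA : p ∈ (S.bd A).support) :
    (offGraph C).Reachable ⟨.vertex p, hp⟩ (cellPoint C A) :=
  offGraph_reachable (.vertex_cell _ _ hA)

/-- Walking from a point `p` off the cycle to the cycle, the last 1-cell lies in a 2-cell that
meets the cycle. -/
theorem vertex_reachable_meeting_cell {v₀ : V} {C : S.G.Walk v₀ v₀} (p : V) (hp : p ∉ C.support) :
    ∃ A : F, (∃ q ∈ C.support, q ∈ (S.bd A).support) ∧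
      (offGraph C).Reachable ⟨.vertex p, hp⟩ (cellPoint C A) := by
  obtain ⟨w⟩ := S.connected.preconnected p v₀
  have h₀ := C.start_mem_support
  induction w with
  | nil => exact absurd h₀ hp
  | @cons p q _ h w ih =>
    obtain ⟨A, hA⟩ := exists_mem_edges (S := S) (e := s(p, q)) h
    have hpA := fst_mem_support_of_mem_edges _ hA
    have hqA := snd_mem_support_of_mem_edges _ hA
    by_cases hq : q ∈ C.support
    · exact ⟨A, ⟨q, hq, hqA⟩, vertex_reachable_cell hp hpA⟩
    · obtain ⟨B, hB, hr⟩ := ih hq h₀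
      exact ⟨B, hB, (vertex_reachable_cell hp hpA).trans
        ((vertex_reachable_cell hq hqA).symm.trans hr)⟩

theorem cell_reachable_meeting_cell {v₀ : V} {C : S.G.Walk v₀ v₀} (A : F) :
    ∃ B : F, (∃ q ∈ C.support, q ∈ (S.bd B).support) ∧
      (offGraph C).Reachable (cellPoint C A) (cellPoint C B) := by
  have hA := (S.bd A).start_mem_support
  by_cases hp : S.base A ∈ C.support
  · exact ⟨A, ⟨_, hp, hA⟩, .refl _⟩
  · obtain ⟨B, hB, hr⟩ := vertex_reachable_meeting_cell _ hp
    exact ⟨B, hB, (vertex_reachable_cell hp hA).symm.trans hr⟩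

theorem reachable_meeting_cell {v₀ : V} {C : S.G.Walk v₀ v₀} (x : off C) :
    ∃ A : F, (∃ q ∈ C.support, q ∈ (S.bd A).support) ∧
      (offGraph C).Reachable x (cellPoint C A) := by
  obtain ⟨x | e | A, hx⟩ := x
  · exact vertex_reachable_meeting_cell x hx
  · obtain ⟨A, hA⟩ := exists_mem_edges e.2
    obtain ⟨B, hB, hr⟩ := cell_reachable_meeting_cell (C := C) A
    have : (offGraph C).Reachable ⟨.edge e, hx⟩ (cellPoint C A) :=
      offGraph_reachable (.edge_cell _ _ hA)
    exact ⟨B, hB, this.trans hr⟩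
  · exact cell_reachable_meeting_cell A

/-! ### Cycles as boundaries modulo 2 -/

variable (S) in
/-- The set `K` of 1-cells is the sum modulo 2 of the boundaries of the 2-cells in `D`. -/
def IsMod2Boundary (D : Finset F) (K : Set (Sym2 V)) : Prop :=
  ∀ e : Sym2 V, e ∈ K ↔ Odd {A : F | A ∈ D ∧ e ∈ (S.bd A).edges}.ncard

open Classical in
theorem isMod2Boundary_symmDiff {D D' : Finset F} {K K' : Set (Sym2 V)}
    (h : S.IsMod2Boundary D K) (h' : S.IsMod2Boundary D' K') :
    S.IsMod2Boundary (symmDiff D D') (symmDiff K K') := by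
  intro e
  have hcard (E : Finset F) : {A : F | A ∈ E ∧ e ∈ (S.bd A).edges}.ncard =
      (E.filter fun A => e ∈ (S.bd A).edges).card := by
    rw [← Set.ncard_coe_finset]; congr; ext; simp
  have key : ((symmDiff D D').filter fun A => e ∈ (S.bd A).edges).card +
      2 * ((D ∩ D').filter fun A => e ∈ (S.bd A).edges).card =
      (D.filter fun A => e ∈ (S.bd A).edges).card +
      (D'.filter fun A => e ∈ (S.bd A).edges).card := by
    simp only [Finset.card_filter]
    have hs : ∑ A ∈ symmDiff D D', (if e ∈ (S.bd A).edges then 1 else 0) +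
        ∑ A ∈ D ∩ D', (if e ∈ (S.bd A).edges then 1 else 0) =
        ∑ A ∈ D ∪ D', (if e ∈ (S.bd A).edges then 1 else 0) := by
      rw [← Finset.sum_union]
      · congr 1; ext; simp [Finset.mem_symmDiff]; tauto
      · rw [Finset.disjoint_left]; intro A; simp [Finset.mem_symmDiff]; tauto
    have := Finset.sum_union_inter (s₁ := D) (s₂ := D')
      (f := fun A => if e ∈ (S.bd A).edges then 1 else 0)
    omega
  rw [Set.mem_symmDiff, h e, h' e, hcard, hcard, hcard]
  simp only [Nat.odd_iff]
  omega

/-- Along a sequence of gradually varied paths, the symmetric difference of the first and the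
last one is a boundary modulo 2. -/
theorem exists_isMod2Boundary_symmDiff {p q : V} {P Q : S.G.Path p q}
    (h : Relation.ReflTransGen (fun R R' : S.G.Path p q =>
      SideGraduallyVaried (R : S.G.Walk p q) (R' : S.G.Walk p q)) P Q) :
    ∃ D : Finset F, S.IsMod2Boundary D
      (symmDiff {e | e ∈ (P : S.G.Walk p q).edges} {e | e ∈ (Q : S.G.Walk p q).edges}) := by
  classical
  induction h with
  | refl => exact ⟨∅, fun e => by simp⟩
  | tail _ h ih =>
    obtain ⟨D, hD⟩ := ih
    obtain ⟨D', -, hD'⟩ := h.1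
    refine ⟨symmDiff D D', ?_⟩
    have := isMod2Boundary_symmDiff hD (D' := D') hD'
    rwa [symmDiff_assoc, symmDiff_symmDiff_cancel_left] at this

theorem SimplyConnected.exists_isMod2Boundary (hS : S.SimplyConnected) {v₀ : V}
    {C : S.G.Walk v₀ v₀} (hC : C.IsCycle) :
    ∃ D : Finset F, S.IsMod2Boundary D {e | e ∈ C.edges} := by
  cases C with
  | nil => exact absurd hC (by simp)
  | @cons _ v₁ _ h w =>
    obtain ⟨hw, he⟩ := (cons_isCycle_iff w h).1 hC
    -- the two arcs are the first 1-cell and the rest of the cycle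
    let P : S.G.Path v₀ v₁ := SimpleGraph.Path.singleton h
    let Q : S.G.Path v₀ v₁ := ⟨w.reverse, hw.reverse⟩
    have hPQ : ((P : S.G.Walk v₀ v₁).append (Q : S.G.Walk v₀ v₁).reverse).IsCycle := by
      simpa [P, Q, SimpleGraph.Path.singleton] using hC
    obtain ⟨D, hD⟩ := exists_isMod2Boundary_symmDiff (hS v₀ v₁ P Q hPQ)
    refine ⟨D, ?_⟩
    convert hD using 1
    ext e
    simp only [Set.mem_symmDiff, Set.mem_ofPred_eq, P, Q, SimpleGraph.Path.singleton, edges_cons,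
      edges_nil, edges_reverse, List.mem_cons, List.mem_reverse, List.not_mem_nil, or_false]
    constructor
    · rintro (rfl | h)
      · exact .inl ⟨rfl, he⟩
      · exact .inr ⟨h, by rintro rfl; exact he h⟩
    · tauto

/-! ### A finite set of 2-cells separates the two sides of its boundary -/

/-- By coherence no third 2-cell contains the 1-cell `e`, so `e` is counted oddly often exactly if
one of the two 2-cells is in `D`. -/
theorem IsMod2Boundary.mem_edges_iff {D : Finset F} {K : Set (Sym2 V)}
    (hD : S.IsMod2Boundary D K) {A B : F} (hAB : A ≠ B) {e : Sym2 V}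
    (hA : e ∈ (S.bd A).edges) (hB : e ∈ (S.bd B).edges) : e ∈ K ↔ (A ∈ D ↔ B ∉ D) := by
  have hall (X : F) (hX : e ∈ (S.bd X).edges) : X = A ∨ X = B := by
    induction e with
    | h x y =>
    rcases mem_edges_iff_traverses.1 hA with a | a <;>
    rcases mem_edges_iff_traverses.1 hB with b | b <;>
    rcases mem_edges_iff_traverses.1 hX with c | c <;>
    first
      | exact absurd (eq_of_traverses a b) hAB
      | exact .inl (eq_of_traverses c a)
      | exact .inr (eq_of_traverses c b)
  rw [hD e]
  by_cases h1 : A ∈ D <;> by_cases h2 : B ∈ D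
  · have : {X : F | X ∈ D ∧ e ∈ (S.bd X).edges} = {A, B} := by
      ext X; simp only [Set.mem_ofPred_eq, Set.mem_insert_iff, Set.mem_singleton_iff]
      exact ⟨fun h => hall X h.2, by rintro (rfl | rfl) <;> simp [*]⟩
    simp [this, Set.ncard_pair hAB, h1, h2]
  · have : {X : F | X ∈ D ∧ e ∈ (S.bd X).edges} = {A} := by
      ext X; simp only [Set.mem_ofPred_eq, Set.mem_singleton_iff]
      refine ⟨fun h => (hall X h.2).resolve_right ?_, by rintro rfl; simp [*]⟩
      rintro rfl; exact h2 h.1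
    simp [this, h1, h2]
  · have : {X : F | X ∈ D ∧ e ∈ (S.bd X).edges} = {B} := by
      ext X; simp only [Set.mem_ofPred_eq, Set.mem_singleton_iff]
      refine ⟨fun h => (hall X h.2).resolve_left ?_, by rintro rfl; simp [*]⟩
      rintro rfl; exact h1 h.1
    simp [this, h1, h2]
  · have : {X : F | X ∈ D ∧ e ∈ (S.bd X).edges} = ∅ := by
      ext X; simp only [Set.mem_ofPred_eq, Set.mem_empty_iff_false, iff_false]
      rintro ⟨h, h'⟩
      rcases hall X h' with rfl | rfl <;> contradiction
    simp [this, h1, h2]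

theorem IsMod2Boundary.mem_iff_of_linked {D : Finset F} {K : Set (Sym2 V)}
    (hD : S.IsMod2Boundary D K) {A B : F} (h : S.Linked K A B) : A ∈ D ↔ B ∈ D := by
  induction h with
  | refl => rfl
  | @tail X Y _ h ih =>
    obtain ⟨e, he, h1, h2⟩ := h
    rw [ih]
    by_cases hXY : X = Y
    · rw [hXY]
    · have := hD.mem_edges_iff hXY h1 h2
      tauto

variable (S) in
/-- The extension of a set `D` of 2-cells to the points and pseudo-points of the surface: those
on a 2-cell of `D`. If `D` bounds a cycle `C`, this is a union of components on `S - C`. -/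
def Inside (D : Finset F) : VeblenPoint S → Prop
  | .vertex p => ∃ A ∈ D, p ∈ (S.bd A).support
  | .edge e => ∃ A ∈ D, (e : Sym2 V) ∈ (S.bd A).edges
  | .cell A => A ∈ D

theorem IsMod2Boundary.inside_iff_of_incident {D : Finset F} {v₀ : V} {C : S.G.Walk v₀ v₀}
    (hD : S.IsMod2Boundary D {e | e ∈ C.edges}) {x y : VeblenPoint S} (hx : x ∈ off C)
    (h : S.VeblenIncident x y) : S.Inside D x ↔ S.Inside D y := by
  have hvert {p : V} (hp : p ∉ C.support) {A B : F} (hA : p ∈ (S.bd A).support)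
      (hB : p ∈ (S.bd B).support) : A ∈ D ↔ B ∈ D := by
    refine hD.mem_iff_of_linked (Relation.ReflTransGen.mono ?_ _ _ (S.regular p A B hA hB))
    rintro X Y ⟨x, h1, h2⟩
    exact ⟨s(p, x), fun h => hp (fst_mem_support_of_mem_edges _ h), h1, h2⟩
  cases h with
  | vertex_edge p e hpe =>
    have hpA {A : F} (hA : (e : Sym2 V) ∈ (S.bd A).edges) : p ∈ (S.bd A).support :=
      mem_support_of_mem_edges hA hpe
    constructor
    · rintro ⟨A, hA, hp⟩
      obtain ⟨B, hB⟩ := exists_mem_edges e.2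
      exact ⟨B, (hvert hx hp (hpA hB)).1 hA, hB⟩
    · rintro ⟨A, hA, he⟩
      exact ⟨A, hA, hpA he⟩
  | vertex_cell p A hp =>
    exact ⟨fun ⟨B, hB, hpB⟩ => (hvert hx hpB hp).1 hB, fun hA => ⟨A, hA, hp⟩⟩
  | edge_cell e A he =>
    exact ⟨fun ⟨B, hB, heB⟩ => (hD.mem_iff_of_linked (.single ⟨e, hx, heB, he⟩)).1 hB,
      fun hA => ⟨A, hA, he⟩⟩

theorem IsMod2Boundary.inside_iff_of_reachable {D : Finset F} {v₀ : V} {C : S.G.Walk v₀ v₀}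
    (hD : S.IsMod2Boundary D {e | e ∈ C.edges}) {x y : off C}
    (h : (offGraph C).Reachable x y) : S.Inside D x ↔ S.Inside D y := by
  obtain ⟨w⟩ := h
  induction w with
  | nil => rfl
  | @cons x y _ h _ ih =>
    rw [← ih]
    rcases ((SimpleGraph.fromRel_adj _ _ _).1 (SimpleGraph.induce_adj.1 h)).2 with h | h
    · exact hD.inside_iff_of_incident x.2 h
    · exact (hD.inside_iff_of_incident y.2 h).symm

theorem not_reachable_of_meets (hS : S.SimplyConnected) {v₀ : V} {C : S.G.Walk v₀ v₀}
    (hC : C.IsCycle) (hCb : ∀ p ∈ C.support, p ∉ S.boundary) {A B : F}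
    (hA : MeetsClockwise C A) (hB : MeetsCounterclockwise C B) :
    ¬ (offGraph C).Reachable (cellPoint C A) (cellPoint C B) := by
  intro h
  obtain ⟨D, hD⟩ := hS.exists_isMod2Boundary hC
  obtain ⟨A', B', hne, hA', hB', e, he, h1, h2⟩ := exists_opposite_cells hC hCb
  have i1 : A ∈ D ↔ A' ∈ D := hD.mem_iff_of_linked (linked_of_meetsClockwise hC hCb hA hA')
  have i2 : B ∈ D ↔ B' ∈ D := hD.mem_iff_of_linked (linked_of_meetsCounterclockwise hC hCb hB hB')
  have i3 : A ∈ D ↔ B ∈ D := hD.inside_iff_of_reachable h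
  have i4 := (hD.mem_edges_iff hne h1 h2).1 he
  tauto

end DiscreteSurface

/-! ### The components of the complement of a cycle -/

theorem theorem2 {V : Type u} {F : Type v} (S : DiscreteSurface V F) (hS : S.SimplyConnected)
    {v₀ : V} (C : S.G.Walk v₀ v₀) (hC : C.IsCycle)
    (hCb : ∀ p ∈ C.support, p ∉ S.boundary) :
    -- `S - C` has exactly two components
    Nat.card (DiscreteSurface.offGraph C).ConnectedComponent = 2 ∧
    -- all 2-cells on the clockwise side are connected to each other in `S - C`
    (∀ A A' : F, DiscreteSurface.MeetsClockwise C A → DiscreteSurface.MeetsClockwise C A' →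
      (DiscreteSurface.offGraph C).Reachable
        (DiscreteSurface.cellPoint C A) (DiscreteSurface.cellPoint C A')) ∧
    -- all 2-cells on the counterclockwise side are connected to each other in `S - C`
    (∀ B B' : F, DiscreteSurface.MeetsCounterclockwise C B →
      DiscreteSurface.MeetsCounterclockwise C B' →
      (DiscreteSurface.offGraph C).Reachable
        (DiscreteSurface.cellPoint C B) (DiscreteSurface.cellPoint C B')) ∧
    -- every point of `S - C` is connected to one of these 2-cells
    (∀ x : DiscreteSurface.off C,
      (∃ A : F, DiscreteSurface.MeetsClockwise C A ∧
        (DiscreteSurface.offGraph C).Reachable x (DiscreteSurface.cellPoint C A)) ∨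
      (∃ B : F, DiscreteSurface.MeetsCounterclockwise C B ∧
        (DiscreteSurface.offGraph C).Reachable x (DiscreteSurface.cellPoint C B))) ∧
    -- the two sides are not connected to each other in `S - C`
    (∀ A B : F, DiscreteSurface.MeetsClockwise C A → DiscreteSurface.MeetsCounterclockwise C B →
      ¬ (DiscreteSurface.offGraph C).Reachable
        (DiscreteSurface.cellPoint C A) (DiscreteSurface.cellPoint C B)) := by
  have hcw (A A' : F) (hA : DiscreteSurface.MeetsClockwise C A)
      (hA' : DiscreteSurface.MeetsClockwise C A') :=
    (DiscreteSurface.linked_of_meetsClockwise hC hCb hA hA').reachable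
  have hccw (B B' : F) (hB : DiscreteSurface.MeetsCounterclockwise C B)
      (hB' : DiscreteSurface.MeetsCounterclockwise C B') :=
    (DiscreteSurface.linked_of_meetsCounterclockwise hC hCb hB hB').reachable
  have hcover (x : DiscreteSurface.off C) :
      (∃ A : F, DiscreteSurface.MeetsClockwise C A ∧
        (DiscreteSurface.offGraph C).Reachable x (DiscreteSurface.cellPoint C A)) ∨
      (∃ B : F, DiscreteSurface.MeetsCounterclockwise C B ∧
        (DiscreteSurface.offGraph C).Reachable x (DiscreteSurface.cellPoint C B)) := by
    obtain ⟨A, ⟨q, hq, hqA⟩, hr⟩ := DiscreteSurface.reachable_meeting_cell x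
    exact (DiscreteSurface.meets_of_mem_support hC hq hqA).imp (⟨A, ·, hr⟩) (⟨A, ·, hr⟩)
  have hsep (A B : F) (hA : DiscreteSurface.MeetsClockwise C A)
      (hB : DiscreteSurface.MeetsCounterclockwise C B) :=
    DiscreteSurface.not_reachable_of_meets hS hC hCb hA hB
  refine ⟨?_, hcw, hccw, hcover, hsep⟩
  obtain ⟨A, B, -, hA, hB, -⟩ := DiscreteSurface.exists_opposite_cells hC hCb
  refine Nat.card_eq_two_iff.2
    ⟨(DiscreteSurface.offGraph C).connectedComponentMk (DiscreteSurface.cellPoint C A),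
    (DiscreteSurface.offGraph C).connectedComponentMk (DiscreteSurface.cellPoint C B),
    fun h => hsep A B hA hB (SimpleGraph.ConnectedComponent.eq.1 h),
    Set.eq_univ_of_forall fun c => ?_⟩
  induction c using SimpleGraph.ConnectedComponent.ind with
  | h x =>
    rcases hcover x with ⟨A', hA', hr⟩ | ⟨B', hB', hr⟩
    · exact .inl (SimpleGraph.ConnectedComponent.eq.2 (hr.trans (hcw A' A hA' hA)))
    · exact .inr (SimpleGraph.ConnectedComponent.eq.2 (hr.trans (hccw B' B hB' hB)))
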